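/- Let $L>0$ and let $\mathfrak L_L$ be the set of smooth regular curves $\gamma:\mathbb R\to S^3\subset\mathbb C^2$ with period $L$ that are Legendrian, i.e. $\langle\gamma_x,\gamma\rangle=0$ for the Hermitian product $\langle\cdot,\cdot\rangle$ (linear in its first argument). Let $\widetilde{\mathfrak L}_L$ be its quotient by the maps $\gamma\mapsto e^{i\theta}\,\gamma\circ\varphi$, where $\theta\in\mathbb R$ is constant and $\varphi:\mathbb R\to\mathbb R$ is smooth with $\varphi'>0$ and $\varphi(x+L)=\varphi(x)+L$. The tangent space $T_\gamma\mathfrak L_L$ consists of the fields $V=p\gamma_x+q(i\gamma_x)+r(i\gamma)$ with smooth real $L$-periodic $p,q,r$ such that $r_x=2q\langle\gamma_x,\gamma_x\rangle$, and $T_{[\gamma]}\widetilde{\mathfrak L}_L$ is its quotient by the fields $c\,(i\gamma)+f\gamma_x$ ($c$ constant, $f$ smooth and $L$-periodic). A vector field on $\widetilde{\mathfrak L}_L$ is a choice of an element of $T_{[\gamma]}\widetilde{\mathfrak L}_L$ for every $\gamma$ that is compatible with these maps. For two vector fields with representatives $V,W$ at $\gamma$ put $$\Omega_{[\gamma]}(V,W)=-\int_0^L\det{}_{\mathbb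 R}(\gamma,\gamma_x,V,W)\,dx ,$$ where $(z_1,z_2)\in\mathbb C^2$ is identified with $(\operatorname{Re}z_1,\operatorname{Im}z_1,\operatorname{Re}z_2,\operatorname{Im}z_2)\in\mathbb R^4$; this does not depend on the choices. On real polynomials in $u=u_0,u_1,u_2,\dots$ let $D P=\sum_j u_{j+1}\,\partial P/\partial u_j$ and $E P=\sum_j(-D)^j(\partial P/\partial u_j)$. Let $\rho_j,N_j$ ($j\ge1$) be any sequences of such polynomials (they exist) with $$\rho_1=\tfrac12u^2,\qquad D N_j=u\,D E\rho_j,\qquad D E\rho_{j+1}=D^3E\rho_j+D(uN_j),$$ and put $L_j=2E\rho_j$ and $M_j=D E\rho_j$; thus $u_t=M_j$ is the mKdV hierarchy. Along $\gamma\in\mathfrak L_L$ let $$V_j=N_j\gamma_s+M_j(i\gamma_s)+L_j(i\gamma),$$ where $\partial_s=|\gamma_x|^{-1}\partial_x$ and $u_k$ is replaced by $\partial_s^k\kappa$, with $\kappa=\operatorname{Im}\langle\gamma_{xx},\gamma_x\rangle/\langle\gamma_x,\gamma_x\rangle^{3/2}$ the curvature of $\gamma$. **Proposition.** The $V_j$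 represent vector fields on $\widetilde{\mathfrak L}_L$, and for all $1\le j<m$ these satisfy $\Omega(V_m,V_j)=0$ on $\widetilde{\mathfrak L}_L$; moreover $\int_0^L L_m\,(L_j)_x\,dx=0$ along every $\gamma\in\mathfrak L_L$. -/

import Mathlib

open scoped ContDiff

namespace LegendrianMKdV

/-- Differential polynomials: real polynomials in `u = u_0, u_1, u_2, …`; `MvPolynomial.X j`
is `u_j`. -/
abbrev DiffPoly : Type := MvPolynomial ℕ ℝ

/-- The total derivative `D P = ∑ u_{j+1} ∂P/∂u_j`. -/
noncomputable def totalD : Derivation ℝ DiffPoly DiffPoly :=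
  MvPolynomial.mkDerivation ℝ fun j => MvPolynomial.X (j + 1)

/-- The Euler operator `E P = ∑ (-D)^j (∂P/∂u_j)`. -/
noncomputable def euler (P : DiffPoly) : DiffPoly :=
  ∑ j ∈ P.vars, ((-(totalD : DiffPoly →ₗ[ℝ] DiffPoly)) ^ j) (MvPolynomial.pderiv j P)

/-- The mKdV hierarchy: densities `ρ_j`, `j ≥ 1`, with `ρ_1 = u²/2` and `D E ρ_{j+1} = 𝓔 E ρ_j`,
`𝓔 = D³ + D u D⁻¹ u D`. Here `N_j` is the antiderivative `D⁻¹ (u D E ρ_j)` that occurs in `𝓔 E ρ_j`.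
These equations leave free the constants of integration and the addition of total derivatives to
the densities; all choices are allowed. (The entries with index `0` carry no information.)
That a hierarchy exists is proved below (`exists_hierarchy`). -/
structure Hierarchy where
  ρ : ℕ → DiffPoly
  N : ℕ → DiffPoly
  rho_one : ρ 1 = MvPolynomial.C (1 / 2) * MvPolynomial.X 0 ^ 2
  antideriv : ∀ j, 1 ≤ j → totalD (N j) = MvPolynomial.X 0 * totalD (euler (ρ j))
  recursion : ∀ j, 1 ≤ j → totalD (euler (ρ (j + 1))) =
    totalD (totalD (totalD (euler (ρ j)))) + totalD (MvPolynomial.X 0 * N j)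


/-- `L_j = 2 E ρ_j` -/
noncomputable def Hierarchy.L (H : Hierarchy) (j : ℕ) : DiffPoly := 2 * euler (H.ρ j)
/-- The right-hand side `M_j = D E ρ_j` of the `j`-th equation of the hierarchy. -/
noncomputable def Hierarchy.M (H : Hierarchy) (j : ℕ) : DiffPoly := totalD (euler (H.ρ j))


/-- The Hermitian space `ℂ²`. Mathlib's `inner ℂ x y` is linear in `y`. -/
abbrev C2 : Type := EuclideanSpace ℂ (Fin 2)

/-- `(z₁, z₂) ↦ (Re z₁, Im z₁, Re z₂, Im z₂)`. -/
noncomputable def realCoords (z : C2) : Fin 4 → ℝ :=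
  ![(z 0).re, (z 0).im, (z 1).re, (z 1).im]

/-- The real determinant of four vectors of `ℂ² ≅ ℝ⁴`, taken as columns. -/
noncomputable def detR (a b c d : C2) : ℝ :=
  (Matrix.of ![realCoords a, realCoords b, realCoords c, realCoords d]).transpose.det

/-- Regular parametrized smooth Legendrian curves in `S³` that are periodic with period `L`
(not necessarily the least period). -/
structure LegendrianLoop (L : ℝ) where
  toFun : ℝ → C2
  smooth : ContDiff ℝ ∞ toFun
  norm_eq_one : ∀ x, ‖toFun x‖ = 1
  regular : ∀ x, deriv toFun x ≠ 0
  legendrian : ∀ x, inner ℂ (toFun x) (deriv toFun x) = 0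
  periodic : Function.Periodic toFun L

namespace LegendrianLoop

variable {L : ℝ}

noncomputable def speed (γ : LegendrianLoop L) (x : ℝ) : ℝ := ‖deriv γ.toFun x‖

/-- `κ = Im ⟨γ_xx, γ_x⟩ / ⟨γ_x, γ_x⟩^{3/2}` with `⟨·,·⟩` linear in its first argument. -/
noncomputable def curvature (γ : LegendrianLoop L) (x : ℝ) : ℝ :=
  (inner ℂ (deriv γ.toFun x) (deriv (deriv γ.toFun) x)).im / γ.speed x ^ 3

/-- The derivative `∂/∂s = |γ_x|⁻¹ ∂/∂x` with respect to arclength. -/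
noncomputable def arcDeriv (γ : LegendrianLoop L) (f : ℝ → ℝ) (x : ℝ) : ℝ :=
  deriv f x / γ.speed x

/-- The `j`-th arclength derivative of the curvature. -/
noncomputable def kappa (γ : LegendrianLoop L) (j : ℕ) : ℝ → ℝ :=
  (γ.arcDeriv)^[j] γ.curvature

/-- A differential polynomial with `u_j` replaced by the `j`-th arclength derivative of the
curvature. -/
noncomputable def evalAlong (γ : LegendrianLoop L) (P : DiffPoly) (x : ℝ) : ℝ :=
  MvPolynomial.eval (fun j => γ.kappa j x) P

/-- `V = p γ_x + q (iγ_x) + r (iγ)` with smooth real `L`-periodic `p, q, r` such that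
`r_x = 2 q ⟨γ_x, γ_x⟩`. -/
structure HasComponents (γ : LegendrianLoop L) (p q r : ℝ → ℝ) (V : ℝ → C2) : Prop where
  smooth_p : ContDiff ℝ ∞ p
  smooth_q : ContDiff ℝ ∞ q
  smooth_r : ContDiff ℝ ∞ r
  periodic_p : Function.Periodic p L
  periodic_q : Function.Periodic q L
  periodic_r : Function.Periodic r L
  deriv_r : ∀ x, deriv r x = 2 * q x * γ.speed x ^ 2
  eq : ∀ x, V x = p x • deriv γ.toFun x + q x • (Complex.I • deriv γ.toFun x)
    + r x • (Complex.I • γ.toFun x)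

/-- The tangent space at `γ` of the space of periodic Legendrian curves. -/
def tangentSpace (γ : LegendrianLoop L) : Submodule ℝ (ℝ → C2) where
  carrier := {V | ∃ p q r, γ.HasComponents p q r V}
  zero_mem' := ⟨0, 0, 0, by constructor <;> simp [contDiff_const, Function.Periodic, Pi.zero_def]⟩
  add_mem' := by
    rintro V W ⟨p, q, r, h⟩ ⟨p', q', r', h'⟩
    refine ⟨p + p', q + q', r + r', h.smooth_p.add h'.smooth_p, h.smooth_q.add h'.smooth_q,
      h.smooth_r.add h'.smooth_r, h.periodic_p.add h'.periodic_p, h.periodic_q.add h'.periodic_q,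
      h.periodic_r.add h'.periodic_r, fun x => ?_, fun x => ?_⟩
    · rw [deriv_add (h.smooth_r.differentiable (by simp) x) (h'.smooth_r.differentiable (by simp) x),
        h.deriv_r, h'.deriv_r, Pi.add_apply]
      ring
    · simp only [Pi.add_apply, h.eq, h'.eq, add_smul]
      abel
  smul_mem' := by
    rintro c V ⟨p, q, r, h⟩
    refine ⟨c • p, c • q, c • r, h.smooth_p.const_smul c, h.smooth_q.const_smul c,
      h.smooth_r.const_smul c, h.periodic_p.smul c, h.periodic_q.smul c,
      h.periodic_r.smul c, fun x => ?_, fun x => ?_⟩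
    · rw [deriv_const_smul _ (h.smooth_r.differentiable (by simp) x), h.deriv_r]
      simp only [Pi.smul_apply, smul_eq_mul]
      ring
    · simp only [Pi.smul_apply, h.eq, smul_add, smul_assoc]

/-- The directions `c (iγ) + f γ_x` of rotations along the Clifford fibres and of
reparametrizations. -/
def verticalSpace (γ : LegendrianLoop L) : Submodule ℝ γ.tangentSpace where
  carrier := {V | ∃ (c : ℝ) (f : ℝ → ℝ), ContDiff ℝ ∞ f ∧ Function.Periodic f L ∧
    ∀ x, V.1 x = c • (Complex.I • γ.toFun x) + f x • deriv γ.toFun x}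
  zero_mem' := ⟨0, 0, contDiff_const, fun _ => rfl, fun x => by simp⟩
  add_mem' := by
    rintro V W ⟨c, f, hf, hp, h⟩ ⟨c', f', hf', hp', h'⟩
    refine ⟨c + c', f + f', hf.add hf', hp.add hp', fun x => ?_⟩
    simp only [Submodule.coe_add, Pi.add_apply, h, h', add_smul]
    abel
  smul_mem' := by
    rintro a V ⟨c, f, hf, hp, h⟩
    refine ⟨a • c, a • f, hf.const_smul a, hp.smul a, fun x => ?_⟩
    simp only [Submodule.coe_smul, Pi.smul_apply, h, smul_add, smul_assoc]

/-- The tangent space at `[γ]` of the quotient by rotations and reparametrizations. -/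
abbrev QuotientTangent (γ : LegendrianLoop L) : Type := γ.tangentSpace ⧸ γ.verticalSpace

theorem detR_eq (γ : LegendrianLoop L) {p q r p' q' r' : ℝ → ℝ} {V W : ℝ → C2}
    (hV : γ.HasComponents p q r V) (hW : γ.HasComponents p' q' r' W) (x : ℝ) :
    detR (γ.toFun x) (deriv γ.toFun x) (V x) (W x) =
      (q x * r' x - r x * q' x) * γ.speed x ^ 2 := by
  rw [hV.eq, hW.eq]
  have h1 : ‖γ.toFun x‖ ^ 2 = 1 := by rw [γ.norm_eq_one]; norm_num
  have h2 := γ.legendrian x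
  unfold speed
  generalize γ.toFun x = a at *
  generalize deriv γ.toFun x = b at *
  rw [EuclideanSpace.norm_sq_eq] at h1 ⊢
  rw [PiLp.inner_apply] at h2
  simp only [Fin.sum_univ_two, Complex.sq_norm, Complex.normSq_apply] at h1 h2 ⊢
  have h2r := congrArg Complex.re h2
  have h2i := congrArg Complex.im h2
  simp at h2r h2i
  simp [detR, realCoords, Matrix.det_succ_row_zero, Fin.sum_univ_succ, Fin.succAbove]
  linear_combination (q x * r' x - r x * q' x) *
    (((b 0).re * (b 0).re + (b 0).im * (b 0).im + ((b 1).re * (b 1).re + (b 1).im * (b 1).im)) * h1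
      - ((b 0).re * (a 0).re + (b 0).im * (a 0).im + ((b 1).re * (a 1).re + (b 1).im * (a 1).im)) * h2r
      - (-((b 0).re * (a 0).im) + (b 0).im * (a 0).re +
          (-((b 1).re * (a 1).im) + (b 1).im * (a 1).re)) * h2i)

/-- `-∫₀ᴸ det_ℝ(γ, γ_x, V, W) dx`. -/
noncomputable def omegaRep (γ : LegendrianLoop L) (V W : ℝ → C2) : ℝ :=
  -∫ x in (0 : ℝ)..L, detR (γ.toFun x) (deriv γ.toFun x) (V x) (W x)

theorem omegaRep_eq (γ : LegendrianLoop L) {p q r p' q' r' : ℝ → ℝ} {V W : ℝ → C2}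
    (hV : γ.HasComponents p q r V) (hW : γ.HasComponents p' q' r' W) :
    γ.omegaRep V W = -∫ x in (0 : ℝ)..L, (deriv r x * r' x - r x * deriv r' x) / 2 := by
  unfold omegaRep
  congr 1
  refine intervalIntegral.integral_congr fun x _ => ?_
  simp only [γ.detR_eq hV hW, hV.deriv_r, hW.deriv_r]
  ring

theorem HasComponents.add_vertical {γ : LegendrianLoop L} {p q r : ℝ → ℝ} {V W : γ.tangentSpace}
    (hV : γ.HasComponents p q r V.1) (h : W - V ∈ γ.verticalSpace) :
    ∃ (p' : ℝ → ℝ) (c : ℝ), γ.HasComponents p' q (fun x => r x + c) W.1 := by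
  obtain ⟨c, f, hf, hp, h⟩ := h
  refine ⟨p + f, c, hV.smooth_p.add hf, hV.smooth_q, hV.smooth_r.add contDiff_const,
    hV.periodic_p.add hp, hV.periodic_q, fun x => by simp only [hV.periodic_r x], fun x => ?_,
    fun x => ?_⟩
  · rw [deriv_add_const, hV.deriv_r]
  · have h' := h x
    simp only [Submodule.coe_sub, Pi.sub_apply, hV.eq, sub_eq_iff_eq_add] at h'
    rw [h', Pi.add_apply]
    module

theorem integral_deriv_periodic {r : ℝ → ℝ} (hr : ContDiff ℝ ∞ r) (hp : Function.Periodic r L) :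
    ∫ x in (0 : ℝ)..L, deriv r x = 0 := by
  rw [intervalIntegral.integral_deriv_eq_sub (fun x _ => hr.differentiable (by simp) x)
    ((hr.continuous_deriv (by simp)).intervalIntegrable _ _)]
  simpa [sub_eq_zero] using hp 0

theorem omegaRep_congr (γ : LegendrianLoop L) (V W V' W' : γ.tangentSpace)
    (hV : V' - V ∈ γ.verticalSpace) (hW : W' - W ∈ γ.verticalSpace) :
    γ.omegaRep V.1 W.1 = γ.omegaRep V'.1 W'.1 := by
  obtain ⟨p, q, r, h1⟩ := V.2
  obtain ⟨p', q', r', h2⟩ := W.2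
  obtain ⟨p₁, c, h3⟩ := h1.add_vertical hV
  obtain ⟨p₂, c', h4⟩ := h2.add_vertical hW
  rw [γ.omegaRep_eq h1 h2, γ.omegaRep_eq h3 h4, neg_inj, ← sub_eq_zero]
  have i1 := (h1.smooth_r.continuous_deriv (by simp))
  have i2 := (h2.smooth_r.continuous_deriv (by simp))
  have i3 := h1.smooth_r.continuous
  have i4 := h2.smooth_r.continuous
  simp only [deriv_add_const]
  rw [← intervalIntegral.integral_sub
    (Continuous.intervalIntegrable (by fun_prop) _ _)
    (Continuous.intervalIntegrable (by fun_prop) _ _)]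
  have : ∀ x, (deriv r x * r' x - r x * deriv r' x) / 2 -
      (deriv r x * (r' x + c') - (r x + c) * deriv r' x) / 2 =
      (-c' / 2) * deriv r x + c / 2 * deriv r' x := fun x => by ring
  simp only [this]
  rw [intervalIntegral.integral_add (Continuous.intervalIntegrable (by fun_prop) _ _)
    (Continuous.intervalIntegrable (by fun_prop) _ _), intervalIntegral.integral_const_mul,
    intervalIntegral.integral_const_mul, integral_deriv_periodic h1.smooth_r h1.periodic_r,
    integral_deriv_periodic h2.smooth_r h2.periodic_r]
  simp

/-- The skew form `Ω_[γ]` on the tangent space at `[γ]`, computed from any representatives. -/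
noncomputable def omega (γ : LegendrianLoop L) (v w : γ.QuotientTangent) : ℝ :=
  Quotient.liftOn₂' v w (fun V W => γ.omegaRep V.1 W.1) fun V W V' W' hV hW =>
    γ.omegaRep_congr V W V' W'
      (by rw [← neg_sub]; exact γ.verticalSpace.neg_mem ((Submodule.quotientRel_def _).1 hV))
      (by rw [← neg_sub]; exact γ.verticalSpace.neg_mem ((Submodule.quotientRel_def _).1 hW))

/-- A rotation along the Clifford fibres together with a reparametrization fixing the period.
(For `L > 0` such a `reparam` is automatically a diffeomorphism of `ℝ`.) -/
structure Symmetry (L : ℝ) where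
  phase : Circle
  reparam : ℝ → ℝ
  smooth : ContDiff ℝ ∞ reparam
  deriv_pos : ∀ x, 0 < deriv reparam x
  shift : ∀ x, reparam (x + L) = reparam x + L

theorem deriv_comp_smul {f : ℝ → C2} (hf : ContDiff ℝ ∞ f) {φ : ℝ → ℝ} (hφ : ContDiff ℝ ∞ φ)
    (c : ℂ) (x : ℝ) :
    deriv (fun y => c • f (φ y)) x = deriv φ x • (c • deriv f (φ x)) := by
  have h1 : HasDerivAt (fun y => f (φ y)) (deriv φ x • deriv f (φ x)) x :=
    ((hf.differentiable (by simp) (φ x)).hasDerivAt).scomp x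
      ((hφ.differentiable (by simp) x).hasDerivAt)
  exact (h1.const_smul c).deriv.trans (smul_comm _ _ _)

/-- The curve `e^{iθ} γ ∘ φ`. -/
noncomputable def act (γ : LegendrianLoop L) (g : Symmetry L) : LegendrianLoop L where
  toFun x := (g.phase : ℂ) • γ.toFun (g.reparam x)
  smooth := (γ.smooth.comp g.smooth).const_smul (g.phase : ℂ)
  norm_eq_one x := by rw [norm_smul, γ.norm_eq_one, Circle.norm_coe, one_mul]
  regular x := by
    rw [deriv_comp_smul γ.smooth g.smooth]
    exact smul_ne_zero (g.deriv_pos x).ne' (smul_ne_zero g.phase.coe_ne_zero (γ.regular _))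
  legendrian x := by
    rw [deriv_comp_smul γ.smooth g.smooth, inner_smul_left, inner_smul_right_eq_smul,
      inner_smul_right, γ.legendrian]
    simp
  periodic x := by simp only [g.shift, γ.periodic _]

theorem act_deriv (γ : LegendrianLoop L) (g : Symmetry L) (x : ℝ) :
    deriv (γ.act g).toFun x = deriv g.reparam x • ((g.phase : ℂ) • deriv γ.toFun (g.reparam x)) :=
  deriv_comp_smul γ.smooth g.smooth _ x

theorem act_speed (γ : LegendrianLoop L) (g : Symmetry L) (x : ℝ) :
    (γ.act g).speed x = deriv g.reparam x * γ.speed (g.reparam x) := by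
  rw [speed, act_deriv, norm_smul, norm_smul, speed, Real.norm_of_nonneg (g.deriv_pos x).le,
    Circle.norm_coe, one_mul]

/-- `γ'` is obtained from `γ` by a rotation and a reparametrization. -/
def OrbitRel (L : ℝ) (γ γ' : LegendrianLoop L) : Prop := ∃ g : Symmetry L, γ' = γ.act g


theorem smooth_deriv {E : Type*} [NormedAddCommGroup E] [NormedSpace ℝ E] {f : ℝ → E}
    (hf : ContDiff ℝ ∞ f) : ContDiff ℝ ∞ (deriv f) :=
  (contDiff_infty_iff_deriv.1 hf).2

theorem HasComponents.push {γ : LegendrianLoop L} (g : Symmetry L) {p q r : ℝ → ℝ} {V : ℝ → C2}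
    (h : γ.HasComponents p q r V) :
    (γ.act g).HasComponents (fun x => p (g.reparam x) / deriv g.reparam x)
      (fun x => q (g.reparam x) / deriv g.reparam x) (fun x => r (g.reparam x))
      (fun x => (g.phase : ℂ) • V (g.reparam x)) := by
  have hd : ∀ x, deriv g.reparam (x + L) = deriv g.reparam x := by
    intro x
    rw [← deriv_comp_add_const]
    simp only [g.shift, deriv_add_const]
  have hs := smooth_deriv g.smooth
  have hne : ∀ x, deriv g.reparam x ≠ 0 := fun x => (g.deriv_pos x).ne'
  refine ⟨(h.smooth_p.comp g.smooth).div hs hne, (h.smooth_q.comp g.smooth).div hs hne,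
    h.smooth_r.comp g.smooth, fun x => ?_, fun x => ?_, fun x => ?_, fun x => ?_, fun x => ?_⟩
  · simp only [g.shift, hd, h.periodic_p _]
  · simp only [g.shift, hd, h.periodic_q _]
  · simp only [g.shift, h.periodic_r _]
  · have : HasDerivAt (fun y => r (g.reparam y))
        (deriv r (g.reparam x) * deriv g.reparam x) x :=
      ((h.smooth_r.differentiable (by simp) _).hasDerivAt).comp x
        ((g.smooth.differentiable (by simp) x).hasDerivAt)
    rw [this.deriv, h.deriv_r, act_speed]
    field_simp [hne x]
  · have e : ∀ (a : ℝ) (v : C2), (a / deriv g.reparam x) • (deriv g.reparam x • v) = a • v :=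
      fun a v => by rw [smul_smul, div_mul_cancel₀ _ (hne x)]
    simp only [h.eq, act_deriv, smul_add, smul_comm Complex.I (deriv g.reparam x), e]
    simp only [act, smul_comm Complex.I (g.phase : ℂ), smul_comm (_ : ℝ) (g.phase : ℂ)]

/-- The differential of `γ ↦ e^{iθ} γ ∘ φ` on tangent vectors. -/
def push (γ : LegendrianLoop L) (g : Symmetry L) (V : γ.tangentSpace) : (γ.act g).tangentSpace :=
  ⟨fun x => (g.phase : ℂ) • V.1 (g.reparam x), by
    obtain ⟨p, q, r, h⟩ := V.2
    exact ⟨_, _, _, h.push g⟩⟩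

theorem omegaRep_push (γ : LegendrianLoop L) (g : Symmetry L) (V W : γ.tangentSpace) :
    (γ.act g).omegaRep (γ.push g V).1 (γ.push g W).1 = γ.omegaRep V.1 W.1 := by
  obtain ⟨p, q, r, h1⟩ := V.2
  obtain ⟨p', q', r', h2⟩ := W.2
  rw [γ.omegaRep_eq h1 h2, (γ.act g).omegaRep_eq (V := (γ.push g V).1) (W := (γ.push g W).1)
    (h1.push g) (h2.push g), neg_inj]
  have i1 := (h1.smooth_r.continuous_deriv (by simp))
  have i2 := (h2.smooth_r.continuous_deriv (by simp))
  have i3 := h1.smooth_r.continuous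
  have i4 := h2.smooth_r.continuous
  have hchain : ∀ {f : ℝ → ℝ}, ContDiff ℝ ∞ f → ∀ x, deriv (fun y => f (g.reparam y)) x =
      deriv f (g.reparam x) * deriv g.reparam x := fun hf x =>
    (((hf.differentiable (by simp) _).hasDerivAt).comp x
        ((g.smooth.differentiable (by simp) x).hasDerivAt)).deriv
  set G : ℝ → ℝ := fun x => (deriv r x * r' x - r x * deriv r' x) / 2 with hG
  have hGp : Function.Periodic G L := by
    have hd : ∀ {f : ℝ → ℝ}, Function.Periodic f L → ∀ x, deriv f (x + L) = deriv f x := by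
      intro f hf x
      rw [← deriv_comp_add_const]
      simp only [hf _]
    intro x
    simp only [hG, hd h1.periodic_r, hd h2.periodic_r, h1.periodic_r x, h2.periodic_r x]
  have : ∀ x, (deriv (fun y => r (g.reparam y)) x * r' (g.reparam x) -
      r (g.reparam x) * deriv (fun y => r' (g.reparam y)) x) / 2 =
      (G ∘ g.reparam) x * deriv g.reparam x := by
    intro x
    rw [hchain h1.smooth_r, hchain h2.smooth_r]
    simp only [hG, Function.comp]
    ring
  simp only [this]
  rw [intervalIntegral.integral_comp_mul_deriv
    (fun x _ => (g.smooth.differentiable (by simp) x).hasDerivAt)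
    (g.smooth.continuous_deriv (by simp)).continuousOn (by fun_prop)]
  have h0 : g.reparam L = g.reparam 0 + L := by simpa using g.shift 0
  rw [h0, hGp.intervalIntegral_add_eq (g.reparam 0) 0, zero_add]


theorem speed_pos (γ : LegendrianLoop L) (x : ℝ) : 0 < γ.speed x := norm_pos_iff.2 (γ.regular x)

theorem smooth_speed (γ : LegendrianLoop L) : ContDiff ℝ ∞ γ.speed :=
  (smooth_deriv γ.smooth).norm ℂ γ.regular

theorem periodic_deriv {E : Type*} [NormedAddCommGroup E] [NormedSpace ℝ E] {f : ℝ → E}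
    (hf : Function.Periodic f L) : Function.Periodic (deriv f) L := by
  intro x
  rw [← deriv_comp_add_const]
  simp only [hf _]

theorem periodic_speed (γ : LegendrianLoop L) : Function.Periodic γ.speed L := fun x => by
  simp only [speed, periodic_deriv γ.periodic x]

theorem smooth_curvature (γ : LegendrianLoop L) : ContDiff ℝ ∞ γ.curvature :=
  (Complex.imCLM.contDiff.comp
    ((smooth_deriv γ.smooth).inner ℂ (smooth_deriv (smooth_deriv γ.smooth)))).div
    (γ.smooth_speed.pow 3) fun x => pow_ne_zero 3 (γ.speed_pos x).ne'

theorem periodic_curvature (γ : LegendrianLoop L) : Function.Periodic γ.curvature L := fun x => by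
  simp only [curvature, periodic_deriv γ.periodic x, periodic_deriv (periodic_deriv γ.periodic) x,
    γ.periodic_speed x]

theorem kappa_succ (γ : LegendrianLoop L) (j : ℕ) :
    γ.kappa (j + 1) = γ.arcDeriv (γ.kappa j) := Function.iterate_succ_apply' _ _ _

theorem smooth_kappa (γ : LegendrianLoop L) (j : ℕ) : ContDiff ℝ ∞ (γ.kappa j) := by
  induction j with
  | zero => exact γ.smooth_curvature
  | succ j ih =>
    rw [kappa_succ]
    exact (smooth_deriv ih).div γ.smooth_speed fun x => (γ.speed_pos x).ne'

theorem periodic_kappa (γ : LegendrianLoop L) (j : ℕ) : Function.Periodic (γ.kappa j) L := by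
  induction j with
  | zero => exact γ.periodic_curvature
  | succ j ih =>
    rw [kappa_succ]
    intro x
    simp only [arcDeriv, periodic_deriv ih x, γ.periodic_speed x]

theorem periodic_evalAlong (γ : LegendrianLoop L) (P : DiffPoly) :
    Function.Periodic (γ.evalAlong P) L := fun x => by
  simp only [evalAlong, γ.periodic_kappa _ x]

theorem smooth_evalAlong (γ : LegendrianLoop L) (P : DiffPoly) : ContDiff ℝ ∞ (γ.evalAlong P) := by
  unfold evalAlong
  induction P using MvPolynomial.induction_on with
  | C a => simpa using contDiff_const
  | add p q hp hq => simpa using hp.add hq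
  | mul_X p i hp => simpa using hp.mul (γ.smooth_kappa i)

theorem deriv_evalAlong (γ : LegendrianLoop L) (P : DiffPoly) (x : ℝ) :
    deriv (γ.evalAlong P) x = γ.speed x * γ.evalAlong (totalD P) x := by
  have key : HasDerivAt (γ.evalAlong P) (γ.speed x * γ.evalAlong (totalD P) x) x := by
    induction P using MvPolynomial.induction_on with
    | C a =>
      have h : γ.evalAlong (MvPolynomial.C a) = fun _ => a := by funext y; simp [evalAlong]
      rw [h]
      simpa [evalAlong] using hasDerivAt_const x a
    | add p q hp hq =>
      have h : γ.evalAlong (p + q) = γ.evalAlong p + γ.evalAlong q := by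
        funext y; simp [evalAlong]
      rw [h]
      refine (hp.add hq).congr_deriv ?_
      simp only [evalAlong, map_add, mul_add]
    | mul_X p i hp =>
      have hk : HasDerivAt (γ.kappa i) (γ.speed x * γ.kappa (i + 1) x) x := by
        have h := ((γ.smooth_kappa i).differentiable (by simp) x).hasDerivAt
        rwa [kappa_succ, arcDeriv, mul_div_cancel₀ _ (γ.speed_pos x).ne']
      have h : γ.evalAlong (p * MvPolynomial.X i) = γ.evalAlong p * γ.kappa i := by
        funext y; simp [evalAlong]
      rw [h]
      refine (hp.mul hk).congr_deriv ?_
      simp only [evalAlong, Derivation.leibniz, map_add, map_mul, MvPolynomial.eval_X,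
        smul_eq_mul, totalD, MvPolynomial.mkDerivation_X]
      ring
  exact key.deriv

theorem act_curvature (γ : LegendrianLoop L) (g : Symmetry L) (x : ℝ) :
    (γ.act g).curvature x = γ.curvature (g.reparam x) := by
  have h1 : deriv (γ.act g).toFun =
      fun x => deriv g.reparam x • ((g.phase : ℂ) • deriv γ.toFun (g.reparam x)) :=
    funext (γ.act_deriv g)
  have h2 : HasDerivAt (fun x => (g.phase : ℂ) • deriv γ.toFun (g.reparam x))
      (deriv g.reparam x • ((g.phase : ℂ) • deriv (deriv γ.toFun) (g.reparam x))) x := by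
    have hs := smooth_deriv γ.smooth
    have h := deriv_comp_smul hs g.smooth (g.phase : ℂ) x
    rw [← h]
    exact (((hs.comp g.smooth).const_smul (g.phase : ℂ)).differentiable (by simp) x).hasDerivAt
  have h3 : deriv (deriv (γ.act g).toFun) x =
      deriv g.reparam x • (deriv g.reparam x • ((g.phase : ℂ) • deriv (deriv γ.toFun) (g.reparam x)))
      + deriv (deriv g.reparam) x • ((g.phase : ℂ) • deriv γ.toFun (g.reparam x)) := by
    rw [h1]
    exact ((((smooth_deriv g.smooth).differentiable (by simp) x).hasDerivAt).smul h2).deriv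
  have hc : (starRingEnd ℂ) (g.phase : ℂ) * (g.phase : ℂ) = 1 := by
    rw [← Complex.normSq_eq_conj_mul_self]; simp
  have hc' : ∀ a b : C2, inner ℂ ((g.phase : ℂ) • a) ((g.phase : ℂ) • b) = inner ℂ a b := by
    intro a b
    rw [inner_smul_left, inner_smul_right, ← mul_assoc, hc, one_mul]
  have hr : ∀ (t : ℝ) (a b : C2), inner ℂ (t • a) b = t * inner ℂ a b := by
    intro t a b
    rw [← Complex.coe_smul, inner_smul_left, Complex.conj_ofReal]
  have hr' : ∀ (t : ℝ) (a b : C2), inner ℂ a (t • b) = t * inner ℂ a b := by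
    intro t a b
    rw [← Complex.coe_smul, inner_smul_right]
  have hself : (inner ℂ (deriv γ.toFun (g.reparam x)) (deriv γ.toFun (g.reparam x))).im = 0 :=
    by
    simpa using inner_self_im (𝕜 := ℂ) (deriv γ.toFun (g.reparam x))
  have hpos := (g.deriv_pos x).ne'
  have hpos' := (γ.speed_pos (g.reparam x)).ne'
  simp only [curvature, h3, act_speed]
  rw [act_deriv]
  simp only [inner_add_right, hr, hr', hc', Complex.add_im, 
    Complex.im_ofReal_mul, hself]
  field_simp
  simp

theorem act_kappa (γ : LegendrianLoop L) (g : Symmetry L) (j : ℕ) (x : ℝ) :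
    (γ.act g).kappa j x = γ.kappa j (g.reparam x) := by
  induction j generalizing x with
  | zero => exact γ.act_curvature g x
  | succ j ih =>
    have h : (γ.act g).kappa j = fun x => γ.kappa j (g.reparam x) := funext ih
    have hd : HasDerivAt (fun x => γ.kappa j (g.reparam x))
        (deriv (γ.kappa j) (g.reparam x) * deriv g.reparam x) x :=
      (((γ.smooth_kappa j).differentiable (by simp) _).hasDerivAt).comp x
        ((g.smooth.differentiable (by simp) x).hasDerivAt)
    rw [kappa_succ, kappa_succ, arcDeriv, arcDeriv, h, hd.deriv, act_speed]
    have := (g.deriv_pos x).ne'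
    field_simp

theorem act_evalAlong (γ : LegendrianLoop L) (g : Symmetry L) (P : DiffPoly) (x : ℝ) :
    (γ.act g).evalAlong P x = γ.evalAlong P (g.reparam x) := by
  simp only [evalAlong, act_kappa]

/-- `γ_s = |γ_x|⁻¹ γ_x`. -/
noncomputable def unitTangent (γ : LegendrianLoop L) (x : ℝ) : C2 :=
  (γ.speed x)⁻¹ • deriv γ.toFun x

/-- `V_j = N_j γ_s + M_j (iγ_s) + L_j (iγ)`. -/
noncomputable def mKdVRep (γ : LegendrianLoop L) (H : Hierarchy) (j : ℕ) (x : ℝ) : C2 :=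
  γ.evalAlong (H.N j) x • γ.unitTangent x
    + γ.evalAlong (H.M j) x • (Complex.I • γ.unitTangent x)
    + γ.evalAlong (H.L j) x • (Complex.I • γ.toFun x)

theorem mKdVRep_components (γ : LegendrianLoop L) (H : Hierarchy) (j : ℕ) :
    γ.HasComponents (fun x => γ.evalAlong (H.N j) x / γ.speed x)
      (fun x => γ.evalAlong (H.M j) x / γ.speed x) (γ.evalAlong (H.L j)) (γ.mKdVRep H j) := by
  have hne : ∀ x, γ.speed x ≠ 0 := fun x => (γ.speed_pos x).ne'
  refine ⟨(γ.smooth_evalAlong _).div γ.smooth_speed hne,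
    (γ.smooth_evalAlong _).div γ.smooth_speed hne, γ.smooth_evalAlong _, fun x => ?_, fun x => ?_,
    γ.periodic_evalAlong _, fun x => ?_, fun x => ?_⟩
  · simp only [γ.periodic_evalAlong _ x, γ.periodic_speed x]
  · simp only [γ.periodic_evalAlong _ x, γ.periodic_speed x]
  · have hD : totalD (H.L j) = 2 * H.M j := by
      have := totalD.map_natCast 2
      simp only [Hierarchy.L, Hierarchy.M, Derivation.leibniz, smul_eq_mul]
      rw [show totalD (2 : DiffPoly) = 0 by simpa using this]
      simp
    have h2 : γ.evalAlong (2 * H.M j) x = 2 * γ.evalAlong (H.M j) x := by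
      simp [evalAlong]
    rw [deriv_evalAlong, hD, h2]
    have := hne x
    field_simp
  · simp only [mKdVRep, unitTangent, div_eq_mul_inv, mul_smul, smul_comm Complex.I (γ.speed x)⁻¹]

end LegendrianLoop

/-- The quotient of the space of `L`-periodic Legendrian curves by rotations and
reparametrizations. -/
def LegendrianLoopSpace (L : ℝ) : Type := Quot (LegendrianLoop.OrbitRel L)

/-- A vector field on the quotient: a tangent vector at `[γ]` for every `γ`, such that equivalent
curves are given corresponding tangent vectors. -/
structure QuotientVectorField (L : ℝ) where
  field : (γ : LegendrianLoop L) → γ.QuotientTangent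
  equivariant : ∀ (γ : LegendrianLoop L) (g : LegendrianLoop.Symmetry L) (V : γ.tangentSpace),
    field γ = Submodule.Quotient.mk V → field (γ.act g) = Submodule.Quotient.mk (γ.push g V)

/-- The function `Ω(V, W)` on the quotient. -/
noncomputable def Omega {L : ℝ} (V W : QuotientVectorField L) : LegendrianLoopSpace L → ℝ :=
  Quot.lift (fun γ => γ.omega (V.field γ) (W.field γ)) (by
    rintro γ _ ⟨g, rfl⟩
    obtain ⟨v, hv⟩ := Submodule.Quotient.mk_surjective _ (V.field γ)
    obtain ⟨w, hw⟩ := Submodule.Quotient.mk_surjective _ (W.field γ)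
    simp only [V.equivariant γ g v hv.symm, W.equivariant γ g w hw.symm, ← hv, ← hw]
    exact (γ.omegaRep_push g v w).symm)


/-- The vector field on the quotient that is represented by `V_j`. -/
noncomputable def mKdVField {L : ℝ} (H : Hierarchy) (j : ℕ) : QuotientVectorField L where
  field γ := Submodule.Quotient.mk ⟨γ.mKdVRep H j, _, _, _, γ.mKdVRep_components H j⟩
  equivariant γ g V hV := by
    rw [Submodule.Quotient.eq] at hV ⊢
    obtain ⟨c, f, hf, hp, h⟩ := hV
    have hs := LegendrianLoop.smooth_deriv g.smooth
    have hne : ∀ x, deriv g.reparam x ≠ 0 := fun x => (g.deriv_pos x).ne'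
    refine ⟨c, fun x => f (g.reparam x) / deriv g.reparam x, (hf.comp g.smooth).div hs hne,
      fun x => ?_, fun x => ?_⟩
    · have hd : deriv g.reparam (x + L) = deriv g.reparam x := by
        rw [← deriv_comp_add_const]
        simp only [g.shift, deriv_add_const]
      simp only [g.shift, hd, hp _]
    · have hrep : (γ.act g).mKdVRep H j x = (g.phase : ℂ) • γ.mKdVRep H j (g.reparam x) := by
        have ht : (γ.act g).unitTangent x = (g.phase : ℂ) • γ.unitTangent (g.reparam x) := by
          simp only [LegendrianLoop.unitTangent, LegendrianLoop.act_speed,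
            LegendrianLoop.act_deriv]
          rw [smul_smul, smul_comm (g.phase : ℂ)]
          congr 1
          have := hne x
          field_simp
        simp only [LegendrianLoop.mKdVRep, ht, LegendrianLoop.act_evalAlong, smul_add]
        simp only [LegendrianLoop.act, smul_comm Complex.I (g.phase : ℂ),
          smul_comm (_ : ℝ) (g.phase : ℂ)]
      have h' := h (g.reparam x)
      simp only [Submodule.coe_sub, Pi.sub_apply] at h' ⊢
      rw [hrep]
      simp only [LegendrianLoop.push, LegendrianLoop.act_deriv]
      rw [← smul_sub, h', smul_smul, div_mul_cancel₀ _ (hne x)]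
      simp only [LegendrianLoop.act, smul_add, smul_comm Complex.I (g.phase : ℂ),
          smul_comm (_ : ℝ) (g.phase : ℂ)]

section Existence

theorem core {R : Type*} [CommRing R] [IsDomain R] [Algebra ℝ R] (D δ θ : Derivation ℝ R R)
    (A M N z u v : R) (hz : z ≠ 0) (hδz : δ z = 0) (hθz : θ z = z)
    (hδu : δ u = v) (hθu : θ u = 0)
    (h1 : D A = M) (h2 : z * D M = A - z * (u * N)) (h3 : D N = u * M)
    (h4 : z * (M ^ 2 + N ^ 2 - 1) = A ^ 2)
    (cδ : ∀ f, D (δ f) = δ (D f)) (cθ : ∀ f, D (θ f) = θ (D f)) :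
    δ N - (2 * θ A - A) * v =
      D (-(2 * (A * (δ M * θ N - δ N * θ M) - M * (δ A * θ N - δ N * θ A)
          + N * (δ A * θ M - δ M * θ A))) + A * (M * δ N - N * δ M)) := by
  have hchar : CharZero R := charZero_of_injective_algebraMap (algebraMap ℝ R).injective
  have dA := cδ A
  have dM := cδ M
  have dN := cδ N
  have tA := cθ A
  have tM := cθ M
  have tN := cθ N
  have h2δ := congrArg δ h2
  have h2θ := congrArg θ h2
  have h4δ := congrArg δ h4
  have h4θ := congrArg θ h4
  have D2 : D (2:R) = 0 := by simpa using D.map_natCast 2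
  rw [h1] at dA tA
  rw [h3] at dN tN
  simp only [Derivation.leibniz, map_add, map_sub, smul_eq_mul, pow_two, hδz, hθz, hδu, hθu,
    mul_zero, Derivation.map_one_eq_zero] at h2δ h2θ h4δ h4θ dA dM dN tA tM tN
  have g2δ : z * D (δ M) = δ A - z * (u * δ N + N * v) := by
    rw [dM]; linear_combination h2δ
  have g2θ : z * D (θ M) = θ A - z * (u * θ N) - A := by
    rw [tM]; linear_combination h2θ - h2
  simp only [add_zero, sub_zero] at h4δ h4θ tN
  have k4δ : z * (M * δ M + N * δ N) = A * δ A := by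
    apply mul_left_cancel₀ (two_ne_zero (α := R))
    linear_combination h4δ
  have k4θ : 2 * (z * (M * θ M + N * θ N)) + A ^ 2 = 2 * (A * θ A) := by
    linear_combination h4θ - h4
  apply mul_left_cancel₀ hz
  simp only [Derivation.leibniz, map_add, map_sub, map_neg, smul_eq_mul, D2, dA, dN, tA, tN, h1, h3]
  linear_combination (2 * (A * θ N - N * θ A) + A * N) * g2δ
    + (-2 * (A * δ N - N * δ A)) * g2θ
    + (-2 * (δ A * θ N - δ N * θ A) - A * δ N) * h2
    + (-(v * A) - δ N + 2 * v * θ A) * h4 + N * k4δ - A * v * k4θ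

/-- A derivation acting on the coefficients of a power series. -/
noncomputable def coeffDer {S : Type*} [CommRing S] [Algebra ℝ S] (d : Derivation ℝ S S) :
    Derivation ℝ (PowerSeries S) (PowerSeries S) :=
  Derivation.mk'
    { toFun := fun f => PowerSeries.mk fun n => d (PowerSeries.coeff n f)
      map_add' := by intro f g; ext n; simp
      map_smul' := by intro c f; ext n; simp }
    (by
      intro f g
      ext n
      simp only [LinearMap.coe_mk, AddHom.coe_mk, PowerSeries.coeff_mk, smul_eq_mul, map_add,
        PowerSeries.coeff_mul, map_sum, Derivation.leibniz, Finset.sum_add_distrib]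
      congr 1
      rw [← Finset.Nat.sum_antidiagonal_swap]
      simp)

@[simp] theorem coeff_coeffDer {S : Type*} [CommRing S] [Algebra ℝ S] (d : Derivation ℝ S S)
    (f : PowerSeries S) (n : ℕ) :
    PowerSeries.coeff n (coeffDer d f) = d (PowerSeries.coeff n f) := by
  simp [coeffDer]

/-- The derivation `z d/dz` on power series. -/
noncomputable def eulerDer (S : Type*) [CommRing S] [Algebra ℝ S] :
    Derivation ℝ (PowerSeries S) (PowerSeries S) :=
  ((PowerSeries.X : PowerSeries S) • PowerSeries.derivative S).restrictScalars ℝ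

theorem coeff_eulerDer {S : Type*} [CommRing S] [Algebra ℝ S]
    (f : PowerSeries S) (n : ℕ) :
    PowerSeries.coeff n (eulerDer S f) = n * PowerSeries.coeff n f := by
  cases n with
  | zero => simp [eulerDer]
  | succ n =>
    simp [eulerDer, PowerSeries.coeff_succ_X_mul, PowerSeries.coeff_derivative]
    ring

/-- One step of the recursion for the pairs (A, N). -/
noncomputable def step (n : ℕ) (g : ℕ → DiffPoly × DiffPoly) : ℕ → DiffPoly × DiffPoly :=
  let a : ℕ → DiffPoly := Function.update (fun i => (g i).1) (n + 1)
    (totalD (totalD (g n).1) + MvPolynomial.X 0 * (g n).2)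
  let b : ℕ → DiffPoly := Function.update (fun i => (g i).2) (n + 1) 0
  Function.update g (n + 1) (a (n + 1), MvPolynomial.C (1 / 2) *
    (∑ p ∈ Finset.HasAntidiagonal.antidiagonal (n + 2), a p.1 * a p.2
      - ∑ p ∈ Finset.HasAntidiagonal.antidiagonal (n + 1), totalD (a p.1) * totalD (a p.2)
      - ∑ p ∈ Finset.HasAntidiagonal.antidiagonal (n + 1), b p.1 * b p.2))

noncomputable def hist : ℕ → ℕ → DiffPoly × DiffPoly
  | 0 => Function.update (fun _ => (0, 0)) 0 (0, 1)
  | n + 1 => step n (hist n)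

theorem hist_of_le {k n : ℕ} (h : n ≤ k) : hist k n = hist n n := by
  induction k, h using Nat.le_induction with
  | base => rfl
  | succ k hk ih =>
    rw [← ih]
    change Function.update (hist k) (k + 1) _ n = _
    rw [Function.update_of_ne (by omega)]

noncomputable def seqA : PowerSeries DiffPoly := PowerSeries.mk fun n => (hist n n).1
noncomputable def seqN : PowerSeries DiffPoly := PowerSeries.mk fun n => (hist n n).2

theorem exists_series : ∃ A N : PowerSeries DiffPoly,
    PowerSeries.coeff 0 A = 0 ∧ PowerSeries.coeff 0 N = 1 ∧
    A = PowerSeries.X * (coeffDer totalD (coeffDer totalD A)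
      + PowerSeries.C (MvPolynomial.X 0 : DiffPoly) * N) ∧
    PowerSeries.X * ((coeffDer totalD A) ^ 2 + N ^ 2 - 1) = A ^ 2 := by
  have hA0 : (hist 0 0).1 = 0 := by simp [hist]
  have hN0 : (hist 0 0).2 = 1 := by simp [hist]
  have hAs : ∀ n, (hist (n+1) (n+1)).1 =
      totalD (totalD (hist n n).1) + MvPolynomial.X 0 * (hist n n).2 := by
    intro n; simp [hist, step]
  refine ⟨seqA, seqN, by simpa [seqA] using hA0, by simpa [seqN] using hN0, ?_, ?_⟩
  · ext1 n
    cases n with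
    | zero => simpa [seqA] using hA0
    | succ n =>
      rw [PowerSeries.coeff_succ_X_mul]
      simp [seqA, seqN, hAs]
  · ext1 n
    rcases n with _ | _ | n
    · rw [PowerSeries.coeff_zero_X_mul]
      simp only [seqA, pow_two, PowerSeries.coeff_mul,
        Finset.Nat.antidiagonal_zero, Finset.sum_singleton, PowerSeries.coeff_mk, hA0, mul_zero]
    · have h1 : Finset.HasAntidiagonal.antidiagonal 1 = {((0:ℕ), (1:ℕ)), (1, 0)} := by decide
      rw [PowerSeries.coeff_succ_X_mul]
      simp only [seqA, seqN, map_sub, map_add, pow_two, PowerSeries.coeff_mul, zero_add, h1,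
        Finset.Nat.antidiagonal_zero, Finset.sum_singleton, PowerSeries.coeff_mk, hA0, hN0,
        coeff_coeffDer, map_zero, PowerSeries.coeff_one]
      simp [hA0]
    · rw [PowerSeries.coeff_succ_X_mul]
      simp only [map_sub, map_add, pow_two, PowerSeries.coeff_mul, coeff_coeffDer,
        PowerSeries.coeff_one, Nat.succ_ne_zero, if_false, sub_zero]
      have key : (hist (n+1) (n+1)).2 = MvPolynomial.C (1 / 2) *
        (∑ p ∈ Finset.HasAntidiagonal.antidiagonal (n + 2),
            PowerSeries.coeff p.1 seqA * PowerSeries.coeff p.2 seqA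
          - ∑ p ∈ Finset.HasAntidiagonal.antidiagonal (n + 1), totalD (PowerSeries.coeff p.1 seqA) *
              totalD (PowerSeries.coeff p.2 seqA)
          - (∑ p ∈ Finset.HasAntidiagonal.antidiagonal (n + 1),
            PowerSeries.coeff p.1 seqN * PowerSeries.coeff p.2 seqN
              - 2 * PowerSeries.coeff (n + 1) seqN)) := by
        have hb : ∀ i, i ≤ n + 1 → Function.update (fun i => (hist n i).1) (n + 1)
            (totalD (totalD (hist n n).1) + MvPolynomial.X 0 * (hist n n).2) i =
              PowerSeries.coeff i seqA := by
          intro i hi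
          rcases eq_or_ne i (n + 1) with rfl | hne
          · simp [seqA, hAs]
          · rw [Function.update_of_ne hne, hist_of_le (by omega)]; simp [seqA]
        have hc : ∀ i, i ≤ n → Function.update (fun i => (hist n i).2) (n + 1)
            (0 : DiffPoly) i = PowerSeries.coeff i seqN := by
          intro i hi
          rw [Function.update_of_ne (by omega), hist_of_le (by omega)]; simp [seqN]
        have hA0' : PowerSeries.coeff 0 seqA = 0 := by simpa [seqA] using hA0
        have hN0' : PowerSeries.coeff 0 seqN = 1 := by simpa [seqN] using hN0
        simp only [hist, step, Function.update_self]
        congr 1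
        congr 1
        · congr 1
          · refine Finset.sum_congr rfl fun p hp => ?_
            have hp' := Finset.HasAntidiagonal.mem_antidiagonal.1 hp
            by_cases h1 : p.1 = 0
            · rw [h1, hb 0 (by omega), hA0', zero_mul, zero_mul]
            by_cases h2 : p.2 = 0
            · rw [h2, hb 0 (by omega), hA0', mul_zero, mul_zero]
            rw [hb _ (by omega), hb _ (by omega)]
          · refine Finset.sum_congr rfl fun p hp => ?_
            have hp' := Finset.HasAntidiagonal.mem_antidiagonal.1 hp
            rw [hb _ (by omega), hb _ (by omega)]
        · have : ∀ p ∈ Finset.HasAntidiagonal.antidiagonal (n + 1),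
              PowerSeries.coeff p.1 seqN * PowerSeries.coeff p.2 seqN =
              Function.update (fun i => (hist n i).2) (n + 1) (0 : DiffPoly) p.1 *
                Function.update (fun i => (hist n i).2) (n + 1) (0 : DiffPoly) p.2
              + (if p = (0, n + 1) then PowerSeries.coeff (n + 1) seqN else 0)
              + (if p = (n + 1, 0) then PowerSeries.coeff (n + 1) seqN else 0) := by
            rintro ⟨i, k⟩ hp
            have hp' : i + k = n + 1 := Finset.HasAntidiagonal.mem_antidiagonal.1 hp
            by_cases h1 : i = 0
            · subst h1
              obtain rfl : k = n + 1 := by omega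
              simp [hN0']
            by_cases h2 : k = 0
            · subst h2
              obtain rfl : i = n + 1 := by omega
              simp [hN0']
            simp only [Prod.mk.injEq, h1, h2, false_and, and_false, if_false, add_zero]
            rw [hc _ (by omega), hc _ (by omega)]
          rw [Finset.sum_congr rfl this, Finset.sum_add_distrib, Finset.sum_add_distrib,
            Finset.sum_ite_eq', Finset.sum_ite_eq', if_pos (by simp), if_pos (by simp)]
          ring
      have h2 : (2 : DiffPoly) * MvPolynomial.C (1/2) = 1 := by
        rw [show (2 : DiffPoly) = MvPolynomial.C 2 from (map_ofNat _ 2).symm, ← map_mul]; norm_num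
      have k2 : PowerSeries.coeff (n+1) seqN = (hist (n+1) (n+1)).2 := by simp [seqN]
      rw [← k2] at key
      linear_combination 2 * key + h2 *
        (∑ p ∈ Finset.HasAntidiagonal.antidiagonal (n + 2),
            PowerSeries.coeff p.1 seqA * PowerSeries.coeff p.2 seqA
          - ∑ p ∈ Finset.HasAntidiagonal.antidiagonal (n + 1),
              totalD (PowerSeries.coeff p.1 seqA) * totalD (PowerSeries.coeff p.2 seqA)
          - (∑ p ∈ Finset.HasAntidiagonal.antidiagonal (n + 1),
            PowerSeries.coeff p.1 seqN * PowerSeries.coeff p.2 seqN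
              - 2 * PowerSeries.coeff (n + 1) seqN))

/-- Differential polynomials in `u` (left variables) and a second function `v` (right variables). -/
abbrev TwoPoly : Type := MvPolynomial (ℕ ⊕ ℕ) ℝ

noncomputable def totalD₂ : Derivation ℝ TwoPoly TwoPoly :=
  MvPolynomial.mkDerivation ℝ
    (Sum.elim (fun j => MvPolynomial.X (Sum.inl (j + 1))) (fun j => MvPolynomial.X (Sum.inr (j + 1))))

/-- The variation of `u` in the direction `v`. -/
noncomputable def vary : Derivation ℝ TwoPoly TwoPoly :=
  MvPolynomial.mkDerivation ℝ (Sum.elim (fun j => MvPolynomial.X (Sum.inr j)) (fun _ => 0))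

noncomputable def emb : DiffPoly →ₐ[ℝ] TwoPoly := MvPolynomial.rename Sum.inl

theorem totalD₂_emb (P : DiffPoly) : totalD₂ (emb P) = emb (totalD P) := by
  induction P using MvPolynomial.induction_on with
  | C a => simp [emb, MvPolynomial.rename_C]
  | add p q hp hq => simp [hp, hq]
  | mul_X p i hp =>
    simp only [map_mul, Derivation.leibniz, hp, map_add, smul_eq_mul]
    simp [emb, totalD, totalD₂, MvPolynomial.mkDerivation_X]

theorem totalD₂_vary (P : TwoPoly) : totalD₂ (vary P) = vary (totalD₂ P) := by
  induction P using MvPolynomial.induction_on with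
  | C a => simp
  | add p q hp hq => simp [hp, hq]
  | mul_X p i hp =>
    simp only [map_mul, Derivation.leibniz, hp, map_add, smul_eq_mul]
    rcases i with i | i <;>
    · simp [totalD₂, vary, MvPolynomial.mkDerivation_X]
      ring

theorem vary_emb (P : DiffPoly) (k : ℕ) :
    MvPolynomial.pderiv (Sum.inr k) (vary (emb P)) = emb (MvPolynomial.pderiv k P) := by
  have h0 : ∀ P : DiffPoly, MvPolynomial.pderiv (Sum.inr k) (emb P) = 0 := by
    intro P
    induction P using MvPolynomial.induction_on with
    | C a => simp [emb]
    | add p q hp hq => simp [hp, hq]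
    | mul_X p i hp =>
      rw [map_mul, Derivation.leibniz, hp]
      simp [emb, MvPolynomial.pderiv_X]
  induction P using MvPolynomial.induction_on with
  | C a => simp [emb]
  | add p q hp hq => simp [hp, hq]
  | mul_X p i hp =>
    simp only [map_mul, Derivation.leibniz, hp, h0, map_add, smul_eq_mul]
    have hX : emb (MvPolynomial.X i) = MvPolynomial.X (Sum.inl i) := by simp [emb]
    have hv : vary (MvPolynomial.X (Sum.inl i)) = MvPolynomial.X (Sum.inr i) := by
      simp [vary, MvPolynomial.mkDerivation_X]
    rw [hX, hv]
    rcases eq_or_ne i k with rfl | hne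
    · simp [MvPolynomial.pderiv_X, hX]
    · have : (Sum.inr i : ℕ ⊕ ℕ) ≠ Sum.inr k := by simpa using hne
      simp [MvPolynomial.pderiv_X, hne.symm, hX, Pi.single_apply, hne]

theorem pderiv_totalD₂ (P : TwoPoly) (k : ℕ) :
    MvPolynomial.pderiv (Sum.inr (k + 1)) (totalD₂ P) =
      totalD₂ (MvPolynomial.pderiv (Sum.inr (k + 1)) P) + MvPolynomial.pderiv (Sum.inr k) P := by
  induction P using MvPolynomial.induction_on with
  | C a => simp
  | add p q hp hq => simp only [map_add, hp, hq]; ring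
  | mul_X p i hp =>
    simp only [Derivation.leibniz, hp, map_add, smul_eq_mul]
    rcases i with i | i
    · simp [totalD₂, MvPolynomial.mkDerivation_X, MvPolynomial.pderiv_X]
      ring
    · simp only [totalD₂, MvPolynomial.mkDerivation_X, MvPolynomial.pderiv_X, Sum.elim_inr,
        Pi.single_apply, Sum.inr.injEq]
      split_ifs <;> first | omega | (simp; try ring)

theorem pderiv_zero_totalD₂ (P : TwoPoly) :
    MvPolynomial.pderiv (Sum.inr 0) (totalD₂ P) =
      totalD₂ (MvPolynomial.pderiv (Sum.inr 0) P) := by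
  induction P using MvPolynomial.induction_on with
  | C a => simp
  | add p q hp hq => simp only [map_add, hp, hq]
  | mul_X p i hp =>
    simp only [Derivation.leibniz, hp, map_add, smul_eq_mul]
    rcases i with i | i
    · simp [totalD₂, MvPolynomial.mkDerivation_X, MvPolynomial.pderiv_X]
      ring
    · simp only [totalD₂, MvPolynomial.mkDerivation_X, MvPolynomial.pderiv_X, Sum.elim_inr,
        Pi.single_apply, Sum.inr.injEq]
      split_ifs <;> first | omega | contradiction | (simp; try ring)

/-- The Euler operator in `v`, truncated at order `K`. -/
noncomputable def eulerV (K : ℕ) (P : TwoPoly) : TwoPoly :=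
  ∑ k ∈ Finset.range K, ((-(totalD₂ : TwoPoly →ₗ[ℝ] TwoPoly)) ^ k)
    (MvPolynomial.pderiv (Sum.inr k) P)

theorem eulerV_totalD₂ (K : ℕ) (P : TwoPoly) :
    eulerV (K + 1) (totalD₂ P) = - ((-(totalD₂ : TwoPoly →ₗ[ℝ] TwoPoly)) ^ (K + 1))
      (MvPolynomial.pderiv (Sum.inr K) P) := by
  induction K with
  | zero => simp [eulerV, pderiv_zero_totalD₂]
  | succ K ih =>
    unfold eulerV at ih ⊢
    rw [Finset.sum_range_succ, ih, pderiv_totalD₂, map_add,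
      pow_succ (-(totalD₂ : TwoPoly →ₗ[ℝ] TwoPoly)) (K + 1)]
    simp

theorem pderiv_eq_zero_of_large {σ : Type*} (f : ℕ → σ) (hf : Function.Injective f)
    (P : MvPolynomial σ ℝ) : ∃ K, ∀ k, K ≤ k → MvPolynomial.pderiv (f k) P = 0 := by
  have hfin : {k | f k ∈ P.vars}.Finite := P.vars.finite_toSet.preimage hf.injOn
  obtain ⟨K, hK⟩ := hfin.bddAbove
  refine ⟨K + 1, fun k hk => MvPolynomial.pderiv_eq_zero_of_notMem_vars fun hmem => ?_⟩
  have := hK hmem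
  omega

theorem euler_eq_sum (P : DiffPoly) : ∃ K₀, ∀ K, K₀ ≤ K → euler P =
    ∑ k ∈ Finset.range K, ((-(totalD : DiffPoly →ₗ[ℝ] DiffPoly)) ^ k) (MvPolynomial.pderiv k P) := by
  refine ⟨P.vars.sup id + 1, fun K hK => ?_⟩
  refine Finset.sum_subset (fun k hk => Finset.mem_range.2 ?_) fun k _ hk => ?_
  · exact (Nat.lt_succ_of_le (Finset.le_sup (f := id) hk)).trans_le hK
  · rw [MvPolynomial.pderiv_eq_zero_of_notMem_vars hk, map_zero]

theorem eulerV_vary (P : DiffPoly) :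
    ∃ K₀, ∀ K, K₀ ≤ K → eulerV K (vary (emb P)) = emb (euler P) := by
  obtain ⟨K₀, hK₀⟩ : ∃ K₀, ∀ k ∈ P.vars, k < K₀ :=
    ⟨P.vars.sup id + 1, fun k hk => Nat.lt_succ_of_le (Finset.le_sup (f := id) hk)⟩
  have hpow : ∀ (k : ℕ) (Q : DiffPoly), ((-(totalD₂ : TwoPoly →ₗ[ℝ] TwoPoly)) ^ k) (emb Q) =
      emb (((-(totalD : DiffPoly →ₗ[ℝ] DiffPoly)) ^ k) Q) := by
    intro k
    induction k with
    | zero => simp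
    | succ k ih =>
      intro Q
      rw [pow_succ, pow_succ, Module.End.mul_apply, Module.End.mul_apply, ← ih]
      simp [totalD₂_emb]
  refine ⟨K₀, fun K hK => ?_⟩
  unfold eulerV euler
  rw [map_sum]
  symm
  refine Finset.sum_subset_zero_on_sdiff
    (fun k hk => Finset.mem_range.2 ((hK₀ k hk).trans_le hK)) ?_ ?_
  · intro k hk
    rw [vary_emb, MvPolynomial.pderiv_eq_zero_of_notMem_vars (Finset.mem_sdiff.1 hk).2]
    simp
  · intro k _
    rw [vary_emb, hpow]

theorem eulerV_mul_v (Q : DiffPoly) (K : ℕ) :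
    eulerV (K + 1) (emb Q * MvPolynomial.X (Sum.inr 0)) = emb Q := by
  have h0 : ∀ (k : ℕ) (P : DiffPoly), MvPolynomial.pderiv (Sum.inr k) (emb P) = 0 := by
    intro k P
    induction P using MvPolynomial.induction_on with
    | C a => simp [emb]
    | add p q hp hq => simp [hp, hq]
    | mul_X p i hp =>
      rw [map_mul, Derivation.leibniz, hp]
      simp [emb, MvPolynomial.pderiv_X]
  unfold eulerV
  rw [Finset.sum_range_succ']
  rw [Finset.sum_eq_zero]
  · simp [Derivation.leibniz, h0]
  · intro k _
    simp [Derivation.leibniz, h0, MvPolynomial.pderiv_X]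

theorem exists_hierarchy : Nonempty Hierarchy := by
  obtain ⟨A, N, hA0, hN0, hA, hC⟩ := exists_series
  have hN : coeffDer totalD N = PowerSeries.C (MvPolynomial.X 0 : DiffPoly) * coeffDer totalD A := by
    have hX : coeffDer totalD (PowerSeries.X : PowerSeries DiffPoly) = 0 := by
      ext1 n
      rw [coeff_coeffDer, PowerSeries.coeff_X]
      split_ifs <;> simp
    have h := congrArg (coeffDer totalD) hC
    simp only [Derivation.leibniz, map_add, map_sub, smul_eq_mul, pow_two, hX,
      mul_zero, Derivation.map_one_eq_zero] at h
    have hchar : CharZero (PowerSeries DiffPoly) :=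
      charZero_of_injective_algebraMap (algebraMap ℝ _).injective
    have hNne : N ≠ 0 := by rintro rfl; simp at hN0
    have h2X : (2 : PowerSeries DiffPoly) * PowerSeries.X * N ≠ 0 :=
      mul_ne_zero (mul_ne_zero two_ne_zero PowerSeries.X_ne_zero) hNne
    apply mul_left_cancel₀ h2X
    linear_combination h + 2 * coeffDer totalD A * hA
  have hN1 : ∀ j, totalD (PowerSeries.coeff j N) =
      MvPolynomial.X 0 * totalD (PowerSeries.coeff j A) := by
    intro j
    have := congrArg (PowerSeries.coeff j) hN
    simpa using this
  have hA1 : ∀ j, PowerSeries.coeff (j + 1) A = totalD (totalD (PowerSeries.coeff j A))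
      + MvPolynomial.X 0 * PowerSeries.coeff j N := by
    intro j
    conv_lhs => rw [hA]
    rw [PowerSeries.coeff_succ_X_mul]
    simp
  -- the variational identity
  let Φ := PowerSeries.map (emb : DiffPoly →+* TwoPoly)
  have hΦ : ∀ f, coeffDer totalD₂ (Φ f) = Φ (coeffDer totalD f) := by
    intro f; ext1 n; simp [Φ, totalD₂_emb]
  have hvar := core (coeffDer totalD₂) (coeffDer vary) (eulerDer TwoPoly)
    (Φ A) (Φ (coeffDer totalD A)) (Φ N) PowerSeries.X (PowerSeries.C (MvPolynomial.X (Sum.inl 0)))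
    (PowerSeries.C (MvPolynomial.X (Sum.inr 0))) PowerSeries.X_ne_zero
    (by ext1 n; rw [coeff_coeffDer, PowerSeries.coeff_X]; split_ifs <;> simp)
    (by simp [eulerDer])
    (by ext1 n; rw [coeff_coeffDer, PowerSeries.coeff_C, PowerSeries.coeff_C]
        split_ifs <;> simp [vary, MvPolynomial.mkDerivation_X])
    (by simp [eulerDer]) (hΦ A)
    (by
      rw [hΦ]
      have := congrArg Φ hA
      simp only [Φ, map_mul, map_add, PowerSeries.map_X, PowerSeries.map_C] at this ⊢
      simp only [emb, RingHom.coe_coe, MvPolynomial.rename_X] at this ⊢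
      linear_combination -this)
    (by
      rw [hΦ, hN]
      simp [Φ, emb])
    (by
      have := congrArg Φ hC
      simpa only [Φ, map_mul, map_add, map_sub, map_pow, map_one, PowerSeries.map_X] using this)
    (by intro f; ext1 n; simp [totalD₂_vary])
    (by intro f; ext1 n; simp [coeff_eulerDer])
  have hE : ∀ j, euler (PowerSeries.coeff j N) = (2 * j - 1) * PowerSeries.coeff j A := by
    intro j
    obtain ⟨h, hh⟩ : ∃ h, vary (emb (PowerSeries.coeff j N)) =
        emb ((2 * j - 1) * PowerSeries.coeff j A) * MvPolynomial.X (Sum.inr 0) + totalD₂ h := by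
      obtain ⟨F, hF⟩ : ∃ F, coeffDer vary (Φ N) - (2 * eulerDer TwoPoly (Φ A) - Φ A) *
          PowerSeries.C (MvPolynomial.X (Sum.inr 0)) = coeffDer totalD₂ F := ⟨_, hvar⟩
      refine ⟨PowerSeries.coeff j F, ?_⟩
      · have := congrArg (PowerSeries.coeff j) hF
        rw [coeff_coeffDer, map_sub, coeff_coeffDer, PowerSeries.coeff_mul_C, map_sub,
          show (2 : PowerSeries TwoPoly) = PowerSeries.C 2 from (map_ofNat _ 2).symm,
          PowerSeries.coeff_C_mul, coeff_eulerDer] at this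
        simp only [Φ, PowerSeries.coeff_map] at this
        rw [sub_eq_iff_eq_add] at this
        simp only [RingHom.coe_coe] at this
        rw [this, add_comm]
        congr 1
        simp only [map_mul, map_sub, map_natCast, map_ofNat, map_one]
        ring
    obtain ⟨K₁, hK₁⟩ := eulerV_vary (PowerSeries.coeff j N)
    obtain ⟨K₂, hK₂⟩ := pderiv_eq_zero_of_large (Sum.inr : ℕ → ℕ ⊕ ℕ) Sum.inr_injective h
    have e := hK₁ (max K₁ K₂ + 1) (by omega)
    have hadd : ∀ K P Q, eulerV K (P + Q) = eulerV K P + eulerV K Q := by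
      intro K P Q; simp [eulerV, Finset.sum_add_distrib]
    rw [hh, hadd, eulerV_mul_v, eulerV_totalD₂, hK₂ _ (by omega), map_zero, neg_zero,
      add_zero] at e
    exact (MvPolynomial.rename_injective _ Sum.inl_injective e).symm
  have hsmul : ∀ (c : ℝ) P, euler (c • P) = c • euler P := by
    intro c P
    obtain ⟨K, hK⟩ := euler_eq_sum P
    obtain ⟨K', hK'⟩ := euler_eq_sum (c • P)
    rw [hK (max K K') (by omega), hK' (max K K') (by omega), Finset.smul_sum]
    simp
  have hρ : ∀ j : ℕ, 1 ≤ j →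
      euler ((1 / (2 * (j:ℝ) - 1)) • PowerSeries.coeff j N) = PowerSeries.coeff j A := by
    intro j hj
    have hj' : (2 * (j:ℝ) - 1) ≠ 0 := by
      have : (1:ℝ) ≤ j := by exact_mod_cast hj
      linarith
    rw [hsmul, hE, show ((2:DiffPoly) * (j : DiffPoly) - 1) = MvPolynomial.C (2 * (j:ℝ) - 1) by
        rw [map_sub, map_mul, map_ofNat, map_natCast, map_one],
      ← MvPolynomial.smul_eq_C_mul, smul_smul, one_div, inv_mul_cancel₀ hj', one_smul]
  refine ⟨⟨fun j => (1 / (2 * (j:ℝ) - 1)) • PowerSeries.coeff j N,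
    fun j => PowerSeries.coeff j N, ?_, ?_, ?_⟩⟩
  · have hA1' : PowerSeries.coeff 1 A = MvPolynomial.X 0 := by
      have := hA1 0
      simpa [hA0, hN0] using this
    have h1 : Finset.HasAntidiagonal.antidiagonal 1 = {((0:ℕ), (1:ℕ)), (1, 0)} := by decide
    have h2 : Finset.HasAntidiagonal.antidiagonal 2 = {((0:ℕ), (2:ℕ)), (1, 1), (2, 0)} := by decide
    have := congrArg (PowerSeries.coeff 2) hC
    rw [PowerSeries.coeff_succ_X_mul] at this
    simp [pow_two, PowerSeries.coeff_mul, h1, h2, hA0, hN0, hA1', PowerSeries.coeff_one] at this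
    rw [pow_two, ← this, ← two_mul, ← mul_assoc, 
      show (2 : DiffPoly) = MvPolynomial.C 2 from (map_ofNat _ 2).symm, ← map_mul]
    norm_num

  · intro j hj
    rw [hρ j hj, hN1]
  · intro j hj
    rw [hρ j hj, hρ (j + 1) (by omega), hA1, map_add]
end Existence

end LegendrianMKdV

namespace LegendrianMKdV

/-! The vector fields themselves are already available as `mKdVField`, so the two vanishing
statements remain. By `omegaRep_eq` the form sees only the `iγ`-components r, r' of two tangent
fields: the condition r_x = 2q|γ_x|² turns it into -½ ∫ (r_x r' - r r'_x) dx. For V_m and V_j these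
components are L_m and L_j. After an integration by parts over the period, both claims therefore say
that ∫ L_m (L_j)_x dx = 0. Along a closed curve this follows once L_m D L_j lies in the image of D,
and that is pure differential algebra.

Write ⟨m,j⟩ for the class of Eρ_m · D Eρ_j modulo the image of D. The argument is the Lenard scheme
for the two operators D and 𝓔 = D³ + D u D⁻¹ u D. Skew-adjointness of D gives ⟨m,j⟩ = -⟨j,m⟩
(`mul_totalD_add_mem_range`). Skew-adjointness of 𝓔, together with D Eρ_{j+1} = 𝓔 Eρ_j, gives
⟨m,j+1⟩ = ⟨m+1,j⟩ (`euler_mul_totalD_shift`). Hence ⟨j+d,j⟩ = ⟨j+d-1,j+1⟩: the gap shrinks by two at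
each step until it is 0 or 1, and there skew-symmetry forces the class to vanish
(`euler_mul_totalD_mem_range`).

Only the recursion and the equation for N_j enter, so the choice of integration constants and of
densities plays no role. -/

/-- `P D Q + Q D P` is a total derivative. -/
theorem mul_totalD_add_mem_range (P Q : DiffPoly) :
    P * totalD Q + Q * totalD P ∈ LinearMap.range (totalD : DiffPoly →ₗ[ℝ] DiffPoly) :=
  ⟨P * Q, by simp [Derivation.leibniz]⟩

/-! ### Lenard scheme: products of members of the hierarchy modulo total derivatives. -/

namespace Hierarchy

variable (H : Hierarchy)

/-- The Lenard relation: modulo total derivatives, the pairing of `E ρ_m` and `D E ρ_{j+1}`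
is that of `E ρ_{m+1}` and `D E ρ_j`. -/
theorem euler_mul_totalD_shift {m j : ℕ} (hm : 1 ≤ m) (hj : 1 ≤ j) :
    euler (H.ρ m) * totalD (euler (H.ρ (j + 1))) - euler (H.ρ (m + 1)) * totalD (euler (H.ρ j)) ∈
      LinearMap.range (totalD : DiffPoly →ₗ[ℝ] DiffPoly) := by
  have h1 := H.recursion m hm
  have h2 := H.recursion j hj
  have h3 := H.antideriv m hm
  have h4 := H.antideriv j hj
  set a := euler (H.ρ m)
  set b := euler (H.ρ j)
  -- The primitive comes from integrating a 𝓔b + b 𝓔a by parts. The first three terms have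
  -- derivative a D³b + b D³a. The terms with u N_j and u N_m have derivative a D(u N_j) + b D(u
  -- N_m) plus the excess u N_j Da + u N_m Db. Since u Da = D N_m and u Db = D N_j, that excess is
  -- D(N_m N_j), which explains the sixth term. The last term converts b D Eρ_{m+1} into -Eρ_{m+1} D
  -- b.
  refine ⟨a * totalD (totalD b) + b * totalD (totalD a) - totalD a * totalD b
    + a * (MvPolynomial.X 0 * H.N j) + b * (MvPolynomial.X 0 * H.N m) - H.N m * H.N j
    - euler (H.ρ (m + 1)) * b, ?_⟩
  simp only [Derivation.coeFn_coe, map_add, map_sub, Derivation.leibniz, smul_eq_mul]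
    at h1 h2 h3 h4 ⊢
  linear_combination -a * h2 - b * h1 - H.N j * h3 - H.N m * h4

/-- Trading one index for the other lowers the gap d by two, so induction in steps of two reduces
everything to d = 0 and d = 1, where the class equals its own negative. The index j is quantified
inside because the inductive step uses the smaller gap at j + 1. -/
theorem euler_mul_totalD_mem_range (d : ℕ) : ∀ {j : ℕ}, 1 ≤ j →
    euler (H.ρ (j + d)) * totalD (euler (H.ρ j)) ∈
      LinearMap.range (totalD : DiffPoly →ₗ[ℝ] DiffPoly) := by
  -- Both base cases produce twice the wanted class; the image of D is a real subspace, so the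
  -- factor can be removed.
  have half : ∀ P : DiffPoly, P + P ∈ LinearMap.range (totalD : DiffPoly →ₗ[ℝ] DiffPoly) →
      P ∈ LinearMap.range (totalD : DiffPoly →ₗ[ℝ] DiffPoly) := fun P h => by
    have := Submodule.smul_mem _ (1 / 2 : ℝ) h
    rwa [← two_smul ℝ P, smul_smul, one_div, inv_mul_cancel₀ two_ne_zero, one_smul] at this
  induction d using Nat.twoStepInduction with
  | zero => exact fun {j} _ => half _ (mul_totalD_add_mem_range _ _)
  | one =>
    intro j hj
    -- The shift with m = j reads ⟨j,j+1⟩ = ⟨j+1,j⟩, while skew-symmetry makes these two opposite.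
    -- The difference of the two relations is 2⟨j+1,j⟩.
    have := Submodule.sub_mem _ (mul_totalD_add_mem_range (euler (H.ρ (j + 1))) (euler (H.ρ j)))
      (H.euler_mul_totalD_shift hj hj)
    refine half _ ?_
    convert this using 1
    ring
  | more d ih _ =>
    intro j hj
    -- ⟨j+1+d, j+1⟩ vanishes by induction, and the shift identifies it with ⟨j+d+2, j⟩.
    have h1 := ih (j := j + 1) (by omega)
    have h2 := H.euler_mul_totalD_shift (m := j + 1 + d) (j := j) (by omega) hj
    have := Submodule.sub_mem _ h1 h2
    rwa [sub_sub_cancel, show j + 1 + d + 1 = j + (d + 2) by omega] at this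

theorem L_mul_totalD_L_mem_range {m j : ℕ} (hj : 1 ≤ j) (hjm : j ≤ m) :
    H.L m * totalD (H.L j) ∈ LinearMap.range (totalD : DiffPoly →ₗ[ℝ] DiffPoly) := by
  obtain ⟨d, rfl⟩ := Nat.exists_eq_add_of_le hjm
  -- The factor 4 is the product of the two normalizations L_i = 2 Eρ_i.
  have := Submodule.smul_mem _ (4 : ℝ) (H.euler_mul_totalD_mem_range d hj)
  convert this using 1
  have hL : ∀ i, H.L i = (2 : ℝ) • euler (H.ρ i) := fun i => by
    rw [Hierarchy.L, MvPolynomial.smul_eq_C_mul, map_ofNat]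
  rw [hL, hL, totalD.map_smul, smul_mul_smul_comm]
  norm_num

end Hierarchy

/-! ### From total derivatives to integrals along closed curves. -/

namespace LegendrianLoop

variable {L : ℝ} (γ : LegendrianLoop L)

/-- If `P D Q` is a total derivative, then `∫ P Q_x dx = 0` along every closed curve. -/
theorem integral_evalAlong_mul_deriv {P Q : DiffPoly}
    (h : P * totalD Q ∈ LinearMap.range (totalD : DiffPoly →ₗ[ℝ] DiffPoly)) :
    ∫ x in (0 : ℝ)..L, γ.evalAlong P x * deriv (γ.evalAlong Q) x = 0 := by
  obtain ⟨F, hF⟩ := h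
  -- D is the arclength derivative along γ, so ∂_x contributes one factor |γ_x| on either side: P
  -- Q_x = |γ_x| · P D Q = |γ_x| · D F = F_x. The integral of F_x over a period vanishes.
  refine Eq.trans ?_ (integral_deriv_periodic (γ.smooth_evalAlong F) (γ.periodic_evalAlong F))
  refine intervalIntegral.integral_congr fun x _ => ?_
  have hF' : totalD F = P * totalD Q := hF
  simp only [deriv_evalAlong, hF', evalAlong, map_mul]
  ring

/-- Integration by parts, carried out on differential polynomials: Q D P differs from -P D Q by a
total derivative, so the previous result applies with the roles exchanged. -/
theorem integral_deriv_evalAlong_mul {P Q : DiffPoly}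
    (h : P * totalD Q ∈ LinearMap.range (totalD : DiffPoly →ₗ[ℝ] DiffPoly)) :
    ∫ x in (0 : ℝ)..L, deriv (γ.evalAlong P) x * γ.evalAlong Q x = 0 := by
  have hQP : Q * totalD P ∈ LinearMap.range (totalD : DiffPoly →ₗ[ℝ] DiffPoly) := by
    simpa using Submodule.sub_mem _ (mul_totalD_add_mem_range P Q) h
  simpa only [mul_comm] using γ.integral_evalAlong_mul_deriv hQP

/-- The bridge between geometry and algebra: Ω depends only on the `iγ`-components, and when these
are differential polynomials in the curvature, one algebraic condition kills both halves of the skew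
integrand. -/
theorem omegaRep_eq_zero {P Q : DiffPoly} {p q p' q' : ℝ → ℝ} {V W : ℝ → C2}
    (hV : γ.HasComponents p q (γ.evalAlong P) V) (hW : γ.HasComponents p' q' (γ.evalAlong Q) W)
    (h : P * totalD Q ∈ LinearMap.range (totalD : DiffPoly →ₗ[ℝ] DiffPoly)) :
    γ.omegaRep V W = 0 := by
  have c1 := hV.smooth_r.continuous
  have c2 := hW.smooth_r.continuous
  have d1 := (smooth_deriv hV.smooth_r).continuous
  have d2 := (smooth_deriv hW.smooth_r).continuous
  rw [γ.omegaRep_eq hV hW, intervalIntegral.integral_div, intervalIntegral.integral_sub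
    (Continuous.intervalIntegrable (by fun_prop) _ _)
    (Continuous.intervalIntegrable (by fun_prop) _ _),
    γ.integral_evalAlong_mul_deriv h, γ.integral_deriv_evalAlong_mul h]
  simp

end LegendrianLoop

end LegendrianMKdV

theorem mainTheorem5 (H : LegendrianMKdV.Hierarchy) (L : ℝ) (hL : 0 < L) (m j : ℕ)
    (hj : 1 ≤ j) (hjm : j < m) :
    (∀ c : LegendrianMKdV.LegendrianLoopSpace L,
      LegendrianMKdV.Omega (LegendrianMKdV.mKdVField H m) (LegendrianMKdV.mKdVField H j) c = 0) ∧
    ∀ γ : LegendrianMKdV.LegendrianLoop L,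
      ∫ x in (0 : ℝ)..L, γ.evalAlong (H.L m) x * deriv (γ.evalAlong (H.L j)) x = 0 := by
  have h := H.L_mul_totalD_L_mem_range hj hjm.le
  refine ⟨fun c => ?_, fun γ => γ.integral_evalAlong_mul_deriv h⟩
  -- On the class of γ, `Omega` unfolds definitionally to `omegaRep` of the chosen representatives
  -- `mKdVRep`, whose `iγ`-components are L_m and L_j.
  induction c using Quot.ind with
  | mk γ => exact γ.omegaRep_eq_zero (γ.mKdVRep_components H m) (γ.mKdVRep_components H j) h
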